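/- Let $(W,S)$ be a Coxeter system of finite rank $n$, $S=\{s_1,\dots,s_n\}$, with $W=\langle S\mid s_i^2=1,\ (s_is_j)^{m_{ij}}=1 \text{ for all } i\neq j \text{ with } m_{ij}<\infty\rangle$, where $m_{ij}=m_{ji}\in\{2,3,\dots\}\cup\{\infty\}$ for $i\ne j$. Let $W_n=\langle S\mid s_i^2=1\ (1\le i\le n)\rangle$ be the universal Coxeter group of the same rank, and let $\omega:S^*\to W$ and $\omega_n:S^*\to W_n$ be the canonical surjections from the free monoid of words over $S$. Let $l_R$ and $l_{R_n}$ denote the reflection lengths on $W$ and $W_n$, i.e. for an element $g$ of the respective group the least $k\ge 0$ such that $g$ is a product of $k$ conjugates of elements of $S$. A word $\mathbf{s}\in S^*$ is called $S$-reduced if no shorter word represents $\omega(\mathbf{s})$, and a subword of a word is a (not necessarily consecutive) subsequence of its letters. Let $v\in W$ and let $\mathbf{s}\in S^*$ be an $S$-reduced word with $\omega(\mathbf{s})=v$. Suppose that no $S$-reduced word representing $v$ contains a subword of the form $(s_is_j)^{m_{ij}}$ with $i\neq j$ and $m_{ij}<\infty$. Then $$l_R(v)=l_{R_n}(\omega_n(\mathbf{s})).$$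 -/

import Mathlib

/-- The universal Coxeter matrix on the index set `B`: `1` on the diagonal and `∞` everywhere else
(encoded, as always for `CoxeterMatrix`, by the entry `0`). -/
noncomputable def CoxeterMatrix.universal (B : Type*) : CoxeterMatrix B where
  M := Matrix.of fun i j => open Classical in if i = j then 1 else 0
  isSymm := by
    ext i j
    by_cases h : i = j
    · simp [h]
    · simp [h, Ne.symm h]
  diagonal := by
    intro i
    simp
  off_diagonal := by
    intro i j h
    simp [h]

/-- The length of `g` with respect to `Y`: the least `k` such that `g` is a product of `k` elements
of `Y ∪ Y⁻¹`. -/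
noncomputable def genLength {G : Type*} [Group G] (Y : Set G) (g : G) : ℕ :=
  sInf {k : ℕ | ∃ l : List G, l.length = k ∧ (∀ y ∈ l, y ∈ Y ∨ y⁻¹ ∈ Y) ∧ l.prod = g}

namespace CoxeterSystem

variable {B : Type*} {W : Type*} [Group W] {M : CoxeterMatrix B}

/-- The reflection length: the length with respect to the set of all conjugates of the simple
generators. -/
noncomputable def reflectionLength (cs : CoxeterSystem M W) (w : W) : ℕ :=
  genLength {t : W | cs.IsReflection t} w

/-- The minimum defining the reflection length is over a nonempty set. -/
theorem reflectionLength_set_nonempty (cs : CoxeterSystem M W) (w : W) :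
    {k : ℕ | ∃ l : List W, l.length = k ∧
      (∀ y ∈ l, y ∈ {t : W | cs.IsReflection t} ∨ y⁻¹ ∈ {t : W | cs.IsReflection t}) ∧
      l.prod = w}.Nonempty := by
  obtain ⟨ω, rfl⟩ := cs.wordProd_surjective w
  refine ⟨_, ω.map cs.simple, rfl, ?_, rfl⟩
  intro y hy
  obtain ⟨i, -, rfl⟩ := List.mem_map.1 hy
  exact Or.inl (cs.isReflection_simple i)

end CoxeterSystem

/-- The word `(s_i s_j)^m`, that is `s_i s_j s_i s_j ⋯ s_i s_j` of length `2 * m`. -/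
def pairPowerWord {B : Type*} (i j : B) (m : ℕ) : List B :=
  (List.replicate m [i, j]).flatten

/-- The word `u` has a (not necessarily consecutive) subword `(s_i s_j)^{m_{ij}}` for some
`i ≠ j` with `m_{ij}` finite, i.e. with `M i j ≠ 0`. -/
def CoxeterMatrix.HasBraidRelationSubword {B : Type*} (M : CoxeterMatrix B) (u : List B) : Prop :=
  ∃ i j : B, i ≠ j ∧ M i j ≠ 0 ∧ (pairPowerWord i j (M i j)).Sublist u

/-! The canonical homomorphism from the universal group maps reflections to reflections, which gives
`≤`. For `≥`, Dyer's theorem (`canDelete_of_wordProd_eq_prod`) deletes at most `l_R(v)` letters from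
`s` and leaves a word `t` that is trivial in `W`. As a subword of `s`, `t` has no braid relation
subword, so it is trivial already in the universal group (`universal_wordProd_eq_one`). Conversely,
`k` deletions down to a trivial word exhibit a product of `k` reflections.

The core is `universal_wordProd_eq_one`. A nonempty word trivial in `W` factors as `α x b i β` with
`x b` and `b i` reduced and equal in `W`. By induction `α b β` is universally trivial, so the
reverse of `b` is a subword of `β α`. If `b` ends in a letter `y`, then `x b` has both right
descents `i` and `y` and contains their braid word (`braidWord_sublist`). Following it by `i` and by
the mirrored copy of its tail inside `β α` gives a full power `(s_p s_q)^m`, up to cyclic rotation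
of the word: a contradiction. So `b` is empty and `x = i` cancels. -/

namespace CoxeterMatrix

/-! ### The geometric representation and the exact order of a product of two simple reflections. -/

open Module Polynomial.Chebyshev

variable {B : Type*} (M : CoxeterMatrix B)

/-- The linear form on `B →₀ ℝ` with value `-2 cos (π / M i j)` on the `j`-th simple root
(`-2` when `M i j` is infinite). -/
noncomputable def simpleCoroot (i : B) : Dual ℝ (B →₀ ℝ) :=
  Finsupp.linearCombination ℝ fun j => -2 * Real.cos (Real.pi / M i j)

theorem simpleCoroot_single (i j : B) :
    M.simpleCoroot i (Finsupp.single j 1) = -2 * Real.cos (Real.pi / M i j) := by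
  simp [simpleCoroot]

theorem simpleCoroot_single_self (i : B) : M.simpleCoroot i (Finsupp.single i 1) = 2 := by
  simp [simpleCoroot_single]

/-- The reflection in the `i`-th simple root of the geometric representation. -/
noncomputable def geometricReflection (i : B) : (B →₀ ℝ) ≃ₗ[ℝ] (B →₀ ℝ) :=
  reflection (M.simpleCoroot_single_self i)

theorem simpleCoroot_mul_simpleCoroot (i j : B) :
    M.simpleCoroot i (Finsupp.single j 1) * M.simpleCoroot j (Finsupp.single i 1) - 2 =
      2 * Real.cos (2 * Real.pi / M i j) := by
  rw [simpleCoroot_single, simpleCoroot_single, M.symmetric j i, mul_div_assoc, Real.cos_two_mul]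
  ring

theorem sin_two_pi_div_pos {m : ℕ} (hm : 3 ≤ m) : 0 < Real.sin (2 * Real.pi / m) := by
  have hm' : (3 : ℝ) ≤ m := by exact_mod_cast hm
  apply Real.sin_pos_of_pos_of_lt_pi
  · have := Real.pi_pos
    positivity
  · rw [div_lt_iff₀ (by linarith)]
    nlinarith [Real.pi_pos]

theorem three_le_of_ne {i j : B} (hij : i ≠ j) (h0 : M i j ≠ 0) (h2 : M i j ≠ 2) : 3 ≤ M i j := by
  have := M.off_diagonal i j hij
  omega

theorem geometricReflection_isLiftable : M.IsLiftable M.geometricReflection := by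
  intro i j
  by_cases hij : i = j
  · subst hij
    rw [M.diagonal, pow_one]
    ext1 x
    exact involutive_reflection (M.simpleCoroot_single_self i) x
  by_cases h0 : M i j = 0
  · rw [h0, pow_zero]
  apply LinearEquiv.toLinearMap_injective
  -- Here `θ = π` and `sin θ = 0`, so the sine quotient `hS` below is not available.
  by_cases h2 : M i j = 2
  · have e1 : M.simpleCoroot i (Finsupp.single j 1) = 0 := by
      rw [simpleCoroot_single, h2]; simp
    have e2 : M.simpleCoroot j (Finsupp.single i 1) = 0 := by
      rw [simpleCoroot_single, M.symmetric, h2]; simp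
    rw [h2]
    unfold geometricReflection
    rw [reflection_mul_reflection_pow]
    norm_num [e1, e2]
    ext z w
    simp
    ring
  have hm := M.three_le_of_ne hij h0 h2
  unfold geometricReflection
  rw [reflection_mul_reflection_pow (t := 2 * Real.cos (2 * Real.pi / M i j))
    (ht := (M.simpleCoroot_mul_simpleCoroot i j).symm)]
  have hsin := (sin_two_pi_div_pos hm).ne'
  have hmr : (M i j : ℝ) ≠ 0 := by exact_mod_cast h0
  set θ := 2 * Real.pi / M i j with hθ
  have hmθ : (M i j : ℝ) * θ = 2 * Real.pi := by rw [hθ]; field_simp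
  have hS : ∀ n : ℤ, (S ℝ n).eval (2 * Real.cos θ) = Real.sin ((n + 1) * θ) / Real.sin θ :=
    fun n => by rw [eq_div_iff hsin, S_two_mul_real_cos]
  -- These are the two coefficients by which the power differs from the identity. For `m = 2p` the
  -- factor `S_{p-1}` vanishes, as `pθ = π`; for `m = 2p + 1` the sum `S_p + S_{p-1}` vanishes.
  have key : (S ℝ (((M i j : ℤ) - 2) / 2)).eval (2 * Real.cos θ) *
        ((S ℝ (((M i j : ℤ) - 1) / 2)).eval (2 * Real.cos θ) +
          (S ℝ (((M i j : ℤ) - 3) / 2)).eval (2 * Real.cos θ)) = 0 ∧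
      (S ℝ (((M i j : ℤ) - 1) / 2)).eval (2 * Real.cos θ) *
        ((S ℝ ((M i j : ℤ) / 2)).eval (2 * Real.cos θ) +
          (S ℝ (((M i j : ℤ) - 2) / 2)).eval (2 * Real.cos θ)) = 0 := by
    rcases Nat.even_or_odd' (M i j) with ⟨p, hp | hp⟩
    · have hpθ : (p : ℝ) * θ = Real.pi := by
        have : (M i j : ℝ) = 2 * p := by exact_mod_cast hp
        rw [this] at hmθ
        linarith
      have h1 : ((M i j : ℤ) - 2) / 2 = p - 1 := by omega
      have h2 : ((M i j : ℤ) - 1) / 2 = p - 1 := by omega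
      have h3 : (S ℝ ((p : ℤ) - 1)).eval (2 * Real.cos θ) = 0 := by
        rw [hS]; push_cast; rw [sub_add_cancel, hpθ]; simp
      rw [h1, h2, h3]
      simp
    · have hpθ : ((p : ℝ) + 1) * θ = 2 * Real.pi - p * θ := by
        have : (M i j : ℝ) = 2 * p + 1 := by exact_mod_cast hp
        rw [this] at hmθ
        linarith
      have h1 : ((M i j : ℤ) - 2) / 2 = p - 1 := by omega
      have h2 : ((M i j : ℤ) - 1) / 2 = p := by omega
      have h3 : ((M i j : ℤ) - 3) / 2 = p - 1 := by omega
      have h4 : (M i j : ℤ) / 2 = p := by omega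
      have h5 : (S ℝ (p : ℤ)).eval (2 * Real.cos θ) +
          (S ℝ ((p : ℤ) - 1)).eval (2 * Real.cos θ) = 0 := by
        rw [hS, hS]; push_cast; rw [sub_add_cancel, hpθ, Real.sin_two_pi_sub]; ring
      rw [h1, h2, h3, h4, h5]
      simp
  rw [key.1, key.2, zero_smul, zero_smul, add_zero, add_zero]
  rfl

/-- Comparing coordinates of the image of the `i`-th simple root forces `sin (kθ) = 0` and `cos (kθ)
= 1` when `3 ≤ M i j`, where `θ = 2π / M i j`. -/
theorem dvd_of_geometricReflection_mul_pow_eq_one {i j : B} (hij : i ≠ j) {k : ℕ}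
    (h : (M.geometricReflection i * M.geometricReflection j) ^ k = 1) : M i j ∣ k := by
  have hk := LinearEquiv.congr_fun h (Finsupp.single i 1)
  unfold geometricReflection at hk
  rw [reflection_mul_reflection_pow_apply_self (t := 2 * Real.cos (2 * Real.pi / M i j))
    (ht := (M.simpleCoroot_mul_simpleCoroot i j).symm)] at hk
  have hi := DFunLike.congr_fun hk i
  have hj := DFunLike.congr_fun hk j
  simp only [Finsupp.add_apply, Finsupp.smul_apply, LinearEquiv.coe_one, id_eq,
    Finsupp.single_eq_same, Finsupp.single_eq_of_ne hij, Finsupp.single_eq_of_ne hij.symm,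
    smul_eq_mul, mul_one, mul_zero, add_zero, zero_add, simpleCoroot_single] at hi hj
  rw [M.symmetric j i] at hj
  -- The entry `0` encodes `∞`: then `t = 2` and `S_{k-1}(2) = k`, so only `k = 0` is left.
  by_cases h0 : M i j = 0
  · rw [h0] at hj ⊢
    simp only [CharP.cast_eq_zero, div_zero, Real.cos_zero, mul_one, S_eval_two] at hj
    push_cast at hj
    have : (k : ℝ) = 0 := by linarith
    simpa using this
  by_cases h2 : M i j = 2
  · rw [h2] at hi ⊢
    have : 2 * Real.cos (2 * Real.pi / (2 : ℕ)) = -2 := by norm_num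
    rw [this, S_eval_neg_two, S_eval_neg_two, Int.negOnePow_sub] at hi
    rcases Nat.even_or_odd k with hk | hk
    · exact hk.two_dvd
    · rw [Int.negOnePow_odd _ (by exact_mod_cast hk)] at hi
      push_cast at hi
      norm_num at hi
  have hm := M.three_le_of_ne hij h0 h2
  have hsin := (sin_two_pi_div_pos hm).ne'
  have hmr : (M i j : ℝ) ≠ 0 := by exact_mod_cast h0
  have hcos : Real.cos (Real.pi / M i j) ≠ 0 := by
    have : (3 : ℝ) ≤ M i j := by exact_mod_cast hm
    have hpi := Real.pi_pos
    refine (Real.cos_pos_of_mem_Ioo ⟨?_, ?_⟩).ne'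
    · have : 0 < Real.pi / M i j := by positivity
      linarith
    · rw [div_lt_div_iff₀ (by linarith) (by norm_num)]
      nlinarith
  have hSk : (S ℝ ((k : ℤ) - 1)).eval (2 * Real.cos (2 * Real.pi / M i j)) = 0 := by
    rcases mul_eq_zero.1 hj with h | h
    · exact h
    · simp [hcos] at h
  rw [hSk, add_zero] at hi
  have e1 := S_two_mul_real_cos (2 * Real.pi / M i j) ((k : ℤ) - 1)
  have e2 := S_two_mul_real_cos (2 * Real.pi / M i j) (k : ℤ)
  rw [hSk, zero_mul] at e1
  rw [hi, one_mul] at e2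
  push_cast at e1 e2
  rw [sub_add_cancel] at e1
  rw [add_mul, one_mul, Real.sin_add, ← e1, zero_mul, zero_add] at e2
  have e3 : Real.cos (k * (2 * Real.pi / M i j)) = 1 := by
    apply mul_right_cancel₀ hsin
    rw [← e2, one_mul]
  obtain ⟨n, hn⟩ := (Real.cos_eq_one_iff _).1 e3
  have e4 : (n * (M i j : ℤ) : ℤ) = k := by
    have : (n : ℝ) * M i j = k := by
      have hpi := Real.pi_ne_zero
      field_simp at hn
      linarith
    exact_mod_cast this
  exact Int.natCast_dvd_natCast.1 ⟨n, by rw [← e4, mul_comm]⟩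

end CoxeterMatrix

namespace CoxeterSystem

variable {B : Type*} {W : Type*} [Group W] {M : CoxeterMatrix B} (cs : CoxeterSystem M W)

theorem dvd_of_simple_mul_simple_pow_eq_one {i j : B} (hij : i ≠ j) {k : ℕ}
    (h : (cs.simple i * cs.simple j) ^ k = 1) : M i j ∣ k := by
  apply M.dvd_of_geometricReflection_mul_pow_eq_one hij
  have := congrArg (cs.lift ⟨_, M.geometricReflection_isLiftable⟩) h
  simpa using this

theorem simple_injective : Function.Injective cs.simple := by
  intro i j h
  by_contra hij
  have := cs.dvd_of_simple_mul_simple_pow_eq_one (k := 1) hij (by simp [h])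
  exact M.off_diagonal i j hij (Nat.dvd_one.1 this)

end CoxeterSystem

/-! ### Parity of inversions and the strong exchange condition. -/

namespace CoxeterSystem

open List
open scoped Classical

variable {B : Type*} {W : Type*} [Group W] {M : CoxeterMatrix B} (cs : CoxeterSystem M W)

/-- The sequence has period `M i j`, because `(s_i s_j)^{M i j} = 1`, so its two halves coincide. -/
theorem even_count_leftInvSeq_alternatingWord (i j : B) (t : W) :
    Even (count t (cs.leftInvSeq (alternatingWord i j (2 * M i j)))) := by
  set L := cs.leftInvSeq (alternatingWord i j (2 * M i j)) with hL
  have hlen : L.length = 2 * M i j := by simp [hL]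
  have hhalf : L.drop (M i j) = L.take (M i j) := by
    apply List.ext_getElem
    · simp [hlen]; omega
    · intro n h1 h2
      simp only [length_drop, hlen] at h1
      rw [getElem_drop, getElem_take]
      simp only [hL]
      rw [cs.getElem_leftInvSeq_alternatingWord _ _ _ _ (by omega),
        cs.getElem_leftInvSeq_alternatingWord _ _ _ _ (by omega),
        prod_alternatingWord_eq_mul_pow, prod_alternatingWord_eq_mul_pow]
      have e1 : (2 * (M i j + n) + 1) / 2 = M i j + n := by omega
      have e2 : (2 * n + 1) / 2 = n := by omega
      rw [e1, e2, pow_add, simple_mul_simple_pow', one_mul]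
      simp
  rw [← take_append_drop (M i j) L, count_append, hhalf]
  exact ⟨_, rfl⟩

/-- The action of a simple reflection on pairs of a group element and a sign. -/
noncomputable def signedConj (i : B) : Function.End (W × ZMod 2) :=
  fun p => (cs.simple i * p.1 * cs.simple i, p.2 + if p.1 = cs.simple i then 1 else 0)

theorem prod_signedConj (ω : List B) (p : W × ZMod 2) :
    (ω.map cs.signedConj).prod p =
      (cs.wordProd ω * p.1 * (cs.wordProd ω)⁻¹, p.2 + count p.1 (cs.rightInvSeq ω)) := by
  induction ω with
  | nil =>
    rw [map_nil, prod_nil]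
    change p = _
    simp
  | cons i ω ih =>
    rw [map_cons, prod_cons]
    change cs.signedConj i ((ω.map cs.signedConj).prod p) = _
    rw [ih, signedConj, rightInvSeq, count_cons, wordProd_cons]
    have : (cs.wordProd ω * p.1 * (cs.wordProd ω)⁻¹ = cs.simple i) ↔
        ((cs.wordProd ω)⁻¹ * cs.simple i * cs.wordProd ω == p.1) = true := by
      rw [beq_iff_eq]
      constructor
      · intro h; rw [← h]; group
      · intro h; rw [← h]; group
    simp only [this, mul_inv_rev, inv_simple]
    push_cast
    simp only [add_assoc, mul_assoc]

theorem reverse_alternatingWord_two_mul {G : Type*} [Monoid G] (f : B → G) (i j : B) (m : ℕ) :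
    ((alternatingWord i j (2 * m)).reverse.map f).prod = (f j * f i) ^ m := by
  induction m with
  | zero => simp [alternatingWord]
  | succ m ih =>
    rw [show 2 * (m + 1) = 2 * m + 1 + 1 by ring, alternatingWord_succ', alternatingWord_succ']
    rw [reverse_cons, reverse_cons, append_assoc, map_append, prod_append, ih]
    simp [pow_succ]

theorem signedConj_isLiftable : M.IsLiftable cs.signedConj := by
  intro j i
  -- Reversing the word turns right inversion sequences into left ones, where the even count is
  -- known.
  rw [← reverse_alternatingWord_two_mul]
  funext p
  rw [prod_signedConj, rightInvSeq_reverse, count_reverse, M.symmetric j i]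
  have h1 : cs.wordProd (alternatingWord i j (2 * M i j)) = 1 := by
    rw [prod_alternatingWord_eq_mul_pow]; simp
  have h2 := (ZMod.natCast_eq_zero_iff_even).2
    (cs.even_count_leftInvSeq_alternatingWord i j p.1)
  rw [wordProd_reverse, h1, h2]
  change _ = p
  simp

theorem lift_signedConj_wordProd (ω : List B) :
    cs.lift ⟨_, cs.signedConj_isLiftable⟩ (cs.wordProd ω) = (ω.map cs.signedConj).prod := by
  rw [wordProd, map_list_prod, map_map]
  congr 1
  apply map_congr_left
  intro i _
  simp

/-- The parity of the number of occurrences of `t` in the right inversion sequence of any word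
for `w`. -/
noncomputable def inversionParity (w t : W) : ZMod 2 :=
  (cs.lift ⟨_, cs.signedConj_isLiftable⟩ w (t, 0)).2

theorem lift_signedConj_apply (w : W) (p : W × ZMod 2) :
    cs.lift ⟨_, cs.signedConj_isLiftable⟩ w p =
      (w * p.1 * w⁻¹, p.2 + cs.inversionParity w p.1) := by
  obtain ⟨ω, rfl⟩ := cs.wordProd_surjective w
  simp only [inversionParity, lift_signedConj_wordProd, prod_signedConj, zero_add]

theorem inversionParity_wordProd (ω : List B) (t : W) :
    cs.inversionParity (cs.wordProd ω) t = count t (cs.rightInvSeq ω) := by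
  simp only [inversionParity, lift_signedConj_wordProd, prod_signedConj, zero_add]

theorem inversionParity_mul (w w' t : W) :
    cs.inversionParity (w * w') t =
      cs.inversionParity w' t + cs.inversionParity w (w' * t * w'⁻¹) := by
  have := cs.lift_signedConj_apply (w * w') (t, 0)
  rw [map_mul] at this
  change cs.lift ⟨_, cs.signedConj_isLiftable⟩ w
    (cs.lift ⟨_, cs.signedConj_isLiftable⟩ w' (t, 0)) = _ at this
  rw [lift_signedConj_apply, lift_signedConj_apply] at this
  simpa using (congrArg Prod.snd this).symm

/-- Expanding `t = w s w⁻¹` by the cocycle rule, the contributions of `w` and `w⁻¹` cancel, leaving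
that of `s`. -/
theorem inversionParity_self {t : W} (ht : cs.IsReflection t) : cs.inversionParity t t = 1 := by
  obtain ⟨w, i, rfl⟩ := ht
  have h1 : cs.inversionParity (cs.simple i) (cs.simple i) = 1 := by
    rw [← wordProd_singleton, inversionParity_wordProd]
    simp
  have h2 : cs.inversionParity w (cs.simple i) +
      cs.inversionParity w⁻¹ (w * cs.simple i * w⁻¹) = 0 := by
    rw [← inversionParity_mul, inv_mul_cancel, ← wordProd_nil, inversionParity_wordProd]
    simp
  have e1 : w⁻¹ * (w * cs.simple i * w⁻¹) * w⁻¹⁻¹ = cs.simple i := by group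
  rw [inversionParity_mul, e1, inversionParity_mul]
  simp only [mul_inv_cancel_right, h1]
  rw [← add_assoc, add_comm, ← add_assoc, h2, zero_add]

theorem mem_rightInvSeq_of_isRightInversion {ω : List B} {t : W}
    (h : cs.IsRightInversion (cs.wordProd ω) t) : t ∈ cs.rightInvSeq ω := by
  by_contra hn
  have h0 : cs.inversionParity (cs.wordProd ω) t = 0 := by
    rw [inversionParity_wordProd, count_eq_zero_of_not_mem hn, Nat.cast_zero]
  -- Right multiplication by `t` flips the parity at `t`; thus `t` would be an inversion of both `w`
  -- and `w t`.
  have h1 : cs.inversionParity (cs.wordProd ω * t) t = 1 := by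
    rw [inversionParity_mul, inversionParity_self cs h.1, mul_inv_cancel_right, h0, add_zero]
  obtain ⟨u, hu, hut⟩ := cs.exists_isReduced (cs.wordProd ω * t)
  rw [hut, inversionParity_wordProd] at h1
  have hmem : t ∈ cs.rightInvSeq u := by
    by_contra hn'
    rw [count_eq_zero_of_not_mem hn'] at h1
    simp at h1
  have := cs.isRightInversion_of_mem_rightInvSeq hu hmem
  rw [← hut] at this
  exact (h.1.isRightInversion_mul_left_iff.1 this) h

/-- The strong exchange condition. -/
theorem IsRightInversion.exists_deletion {ω : List B} {t : W}
    (h : cs.IsRightInversion (cs.wordProd ω) t) :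
    ∃ α x β, ω = α ++ x :: β ∧ cs.wordProd ω * t = cs.wordProd (α ++ β) := by
  obtain ⟨n, hn, rfl⟩ := List.mem_iff_getElem.1 (cs.mem_rightInvSeq_of_isRightInversion h)
  have hn' : n < ω.length := by simpa using hn
  refine ⟨ω.take n, ω[n], ω.drop (n + 1), by simp, ?_⟩
  rw [← List.getD_eq_getElem _ 1 hn, wordProd_mul_getD_rightInvSeq, eraseIdx_eq_take_drop_succ]

/-- Entries occurring once have odd parity, so they all occur in the inversion sequence of any
reduced word for the same element. -/
theorem isReduced_of_nodup_rightInvSeq {ω : List B} (h : (cs.rightInvSeq ω).Nodup) :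
    cs.IsReduced ω := by
  obtain ⟨u, hu, hωu⟩ := cs.exists_isReduced (cs.wordProd ω)
  have hsub : cs.rightInvSeq ω ⊆ cs.rightInvSeq u := by
    intro t ht
    by_contra hn
    have h1 := cs.inversionParity_wordProd ω t
    rw [hωu, inversionParity_wordProd, count_eq_zero_of_not_mem hn,
      count_eq_one_of_mem h ht] at h1
    simp at h1
  have := (h.subperm hsub).length_le
  rw [length_rightInvSeq, length_rightInvSeq, ← hu.eq, ← hωu] at this
  exact le_antisymm (cs.length_wordProd_le ω) this

end CoxeterSystem

/-! ### Dyer's theorem on reflection length and deletion of letters. -/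

namespace CoxeterSystem

open List

variable {B : Type*} {W : Type*} [Group W] {M : CoxeterMatrix B} (cs : CoxeterSystem M W)

/-- At most `k` letters can be deleted from the word `s` so that the remaining word represents the
identity. -/
def CanDelete (k : ℕ) (s : List B) : Prop :=
  ∃ t : List B, t.Sublist s ∧ cs.wordProd t = 1 ∧ s.length ≤ t.length + k

theorem exists_deletion_of_isReflection {s : List B} (h : cs.IsReflection (cs.wordProd s)) :
    ∃ α x β, s = α ++ x :: β ∧ cs.wordProd (α ++ β) = 1 := by
  have h' : cs.IsRightInversion (cs.wordProd s) (cs.wordProd s) := by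
    refine ⟨h, ?_⟩
    rw [h.mul_self, length_one]
    exact h.odd_length.pos
  obtain ⟨α, x, β, hs, hp⟩ := h'.exists_deletion
  exact ⟨α, x, β, hs, by rw [← hp, h.mul_self]⟩

variable {cs}

theorem CanDelete.insert {k : ℕ} {α β : List B} (h : cs.CanDelete k (α ++ β)) (x : B) :
    cs.CanDelete (k + 1) (α ++ x :: β) := by
  obtain ⟨t, ht, h1, hl⟩ := h
  refine ⟨t, ht.trans ((Sublist.refl α).append (sublist_cons_self x β)), h1, ?_⟩
  simp only [length_append, length_cons] at hl ⊢
  omega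

theorem CanDelete.erase {k : ℕ} {α β : List B} {x : B} (h : cs.CanDelete k (α ++ x :: β)) :
    cs.CanDelete (k + 1) (α ++ β) := by
  obtain ⟨t, ht, h1, hl⟩ := h
  obtain ⟨t₁, t₂, rfl, ht₁, ht₂⟩ := sublist_append_iff.1 ht
  simp only [length_append, length_cons] at hl
  rcases sublist_cons_iff.1 ht₂ with ht₂ | ⟨t₃, rfl, ht₃⟩
  · refine ⟨t₁ ++ t₂, ht₁.append ht₂, h1, ?_⟩
    simp only [length_append]
    omega
  -- Removing `x` from a trivial word leaves a reflection, and exchange removes one more letter to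
  -- make it trivial again. The word loses one letter and its trivial subword two, whence `k + 1`.
  · have hr : cs.IsReflection (cs.wordProd (t₁ ++ t₃)) := by
      refine ⟨cs.wordProd t₁, x, ?_⟩
      rw [wordProd_append, wordProd_cons, ← mul_assoc] at h1
      rw [wordProd_append, eq_inv_of_mul_eq_one_right h1, mul_inv_rev, inv_simple, mul_assoc]
    obtain ⟨γ, y, δ, hγ, h1'⟩ := cs.exists_deletion_of_isReflection hr
    refine ⟨γ ++ δ, ?_, h1', ?_⟩
    · have : (γ ++ δ).Sublist (γ ++ y :: δ) := (Sublist.refl γ).append (sublist_cons_self y δ)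
      rw [← hγ] at this
      exact this.trans (ht₁.append ht₃)
    · have := congrArg List.length hγ
      simp only [length_append, length_cons] at this hl ⊢
      omega

theorem _root_.List.Sublist.exists_sublist_erase {A : Type*} {t s : List A} (h : t.Sublist s)
    (hne : t ≠ s) : ∃ α x β, s = α ++ x :: β ∧ t.Sublist (α ++ β) := by
  induction h with
  | slnil => exact absurd rfl hne
  | @cons l₁ l₂ a h _ => exact ⟨[], a, l₂, rfl, h⟩
  | @cons_cons l₁ l₂ a h ih =>
    obtain ⟨α, x, β, rfl, h'⟩ := ih (fun e => hne (by rw [e]))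
    exact ⟨a :: α, x, β, rfl, h'.cons_cons a⟩

/-- Deleting one letter `x` multiplies by a reflection `r`. Either `r` is an inversion of the
element, and the deletion transfers to `s'` by exchange, or it is an inversion after multiplication
by `r`, and exchange yields a word for the original element that is shorter than `s`. -/
theorem CanDelete.of_wordProd_eq {k : ℕ} {s s' : List B} (h : cs.CanDelete k s)
    (hs : cs.wordProd s = cs.wordProd s') : cs.CanDelete k s' := by
  induction hn : s.length using Nat.strong_induction_on generalizing k s s' with
  | _ n ih =>
    obtain ⟨t, ht, h1, hl⟩ := h
    by_cases hts : t = s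
    · exact ⟨s', Sublist.refl _, by rw [← hs, ← hts, h1], by omega⟩
    obtain ⟨α, x, β, rfl, ht'⟩ := ht.exists_sublist_erase hts
    have hlt := ht'.length_le
    simp only [length_append, length_cons] at hl hn hlt
    obtain ⟨k, rfl⟩ : ∃ k', k = k' + 1 := ⟨k - 1, by omega⟩
    have hk : cs.CanDelete k (α ++ β) := ⟨t, ht', h1, by simp only [length_append]; omega⟩
    set r := (cs.wordProd β)⁻¹ * cs.simple x * cs.wordProd β with hr
    have hrefl : cs.IsReflection r := ⟨(cs.wordProd β)⁻¹, x, by rw [hr, inv_inv]⟩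
    have hwr : cs.wordProd s' * r = cs.wordProd (α ++ β) := by
      rw [← hs, hr, wordProd_append, wordProd_append, wordProd_cons]
      simp [mul_assoc]
    by_cases hinv : cs.IsRightInversion (cs.wordProd s') r
    · obtain ⟨α', x', β', rfl, h'⟩ := hinv.exists_deletion
      exact (ih (α ++ β).length (by simp only [length_append]; omega) hk
        (by rw [← hwr, h']) rfl).insert x'
    · rw [← hrefl.isRightInversion_mul_left_iff, hwr] at hinv
      obtain ⟨u, hu, huw⟩ := cs.exists_isReduced (cs.wordProd (α ++ β))
      have hku := ih (α ++ β).length (by simp only [length_append]; omega) hk huw rfl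
      have hul : u.length ≤ (α ++ β).length := by
        rw [← hu.eq, ← huw]; exact cs.length_wordProd_le _
      rw [huw] at hinv
      obtain ⟨γ, y, δ, rfl, h'⟩ := hinv.exists_deletion
      simp only [length_append, length_cons] at hul
      refine ih (γ ++ δ).length (by simp only [length_append]; omega) hku.erase ?_ rfl
      rw [← h', ← huw, ← hwr, mul_assoc, hrefl.mul_self, mul_one]

theorem CanDelete.mul_reflection {k : ℕ} {s s' : List B} (h : cs.CanDelete k s) {r : W}
    (hr : cs.IsReflection r) (hs : cs.wordProd s' = cs.wordProd s * r) :
    cs.CanDelete (k + 1) s' := by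
  have hs' : cs.wordProd s' * r = cs.wordProd s := by rw [hs, mul_assoc, hr.mul_self, mul_one]
  by_cases hinv : cs.IsRightInversion (cs.wordProd s') r
  · obtain ⟨α, x, β, rfl, h'⟩ := hinv.exists_deletion
    exact (h.of_wordProd_eq (by rw [← h', hs'])).insert x
  · rw [← hr.isRightInversion_mul_left_iff, hs'] at hinv
    obtain ⟨γ, y, δ, rfl, h'⟩ := hinv.exists_deletion
    exact h.erase.of_wordProd_eq (by rw [← h', hs])

/-- Dyer's theorem: if a word represents a product of `k` reflections, then it represents the
identity after the deletion of at most `k` letters. -/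
theorem canDelete_of_wordProd_eq_prod {l : List W} (hl : ∀ r ∈ l, cs.IsReflection r) {s : List B}
    (hs : cs.wordProd s = l.prod) : cs.CanDelete l.length s := by
  induction l using List.reverseRecOn generalizing s with
  | nil => exact ⟨s, Sublist.refl _, by simpa using hs, by simp⟩
  | append_singleton l r ih =>
    obtain ⟨u, hu⟩ := cs.wordProd_surjective l.prod
    have hu' := ih (fun r' h' => hl r' (by simp [h'])) hu
    rw [length_append, length_singleton]
    exact hu'.mul_reflection (hl r (by simp)) (by rw [hs, hu]; simp)

end CoxeterSystem

/-! ### Alternating words, and braid words as subwords of reduced words. -/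

namespace CoxeterSystem

open List

variable {B : Type*} {W : Type*} [Group W] {M : CoxeterMatrix B} (cs : CoxeterSystem M W)

theorem isReduced_of_nodup_leftInvSeq {ω : List B} (h : (cs.leftInvSeq ω).Nodup) :
    cs.IsReduced ω := by
  rw [← isReduced_reverse_iff]
  apply isReduced_of_nodup_rightInvSeq
  rwa [rightInvSeq_reverse, nodup_reverse]

theorem nodup_take_leftInvSeq_alternatingWord {i j : B} (hij : i ≠ j) {n : ℕ}
    (hn : M i j = 0 ∨ n ≤ M i j) :
    ((cs.leftInvSeq (alternatingWord i j (2 * n))).take n).Nodup := by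
  rw [List.nodup_iff_injective_getElem]
  suffices h : ∀ a b : ℕ, a < b → b < n →
      cs.wordProd (alternatingWord j i (2 * a + 1)) ≠
        cs.wordProd (alternatingWord j i (2 * b + 1)) by
    rintro ⟨a, ha⟩ ⟨b, hb⟩ hab
    simp only [length_take, length_leftInvSeq, length_alternatingWord] at ha hb
    simp only [getElem_take] at hab
    rw [cs.getElem_leftInvSeq_alternatingWord _ _ _ _ (by omega),
      cs.getElem_leftInvSeq_alternatingWord _ _ _ _ (by omega)] at hab
    rcases lt_trichotomy a b with hlt | rfl | hlt
    · exact absurd hab (h a b hlt (by omega))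
    · rfl
    · exact absurd hab.symm (h b a hlt (by omega))
  intro a b hab hbn h
  rw [prod_alternatingWord_eq_mul_pow, prod_alternatingWord_eq_mul_pow] at h
  have e1 : (2 * a + 1) / 2 = a := by omega
  have e2 : (2 * b + 1) / 2 = a + (b - a) := by omega
  rw [e1, e2] at h
  simp only [Nat.not_even_bit1, if_false, mul_right_inj, pow_add, left_eq_mul] at h
  have hd := cs.dvd_of_simple_mul_simple_pow_eq_one hij.symm h
  rw [M.symmetric j i] at hd
  rcases hn with h0 | hn
  · rw [h0, zero_dvd_iff] at hd
    omega
  · have := Nat.le_of_dvd (by omega) hd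
    omega

theorem isReduced_alternatingWord {i j : B} (hij : i ≠ j) {n : ℕ}
    (hn : M i j = 0 ∨ n ≤ M i j) : cs.IsReduced (alternatingWord i j n) := by
  rcases Nat.eq_zero_or_pos n with rfl | hpos
  · simp [IsReduced, alternatingWord]
  apply isReduced_of_nodup_leftInvSeq
  -- Inversion sequences are known for words of length `2 * n`; the parity of `n` decides which of
  -- the two has the given word as its prefix.
  by_cases he : Even n
  · have := listTake_alternatingWord i j n n (by omega)
    rw [if_pos he] at this
    rw [← this, leftInvSeq_take]
    exact cs.nodup_take_leftInvSeq_alternatingWord hij hn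
  · have := listTake_alternatingWord j i n n (by omega)
    rw [if_neg he] at this
    rw [← this, leftInvSeq_take]
    exact cs.nodup_take_leftInvSeq_alternatingWord hij.symm (by rwa [M.symmetric j i])

theorem isRightDescent_wordProd_concat {u : List B} {z : B} (h : cs.IsReduced (u ++ [z])) :
    cs.IsRightDescent (cs.wordProd (u ++ [z])) z := by
  rw [IsRightDescent, h.eq, wordProd_append, wordProd_singleton, simple_mul_simple_cancel_right,
    length_append, length_singleton]
  exact Nat.lt_succ_of_le (cs.length_wordProd_le u)

theorem isRightDescent_of_not_isReduced_concat {u : List B} {z : B} (hu : cs.IsReduced u)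
    (h : ¬ cs.IsReduced (u ++ [z])) : cs.IsRightDescent (cs.wordProd u) z := by
  by_contra hn
  apply h
  rw [not_isRightDescent_iff] at hn
  rw [IsReduced, wordProd_append, wordProd_singleton, hn, hu.eq, length_append, length_singleton]

variable {cs}

theorem IsReduced.of_append_left {u v : List B} (h : cs.IsReduced (u ++ v)) : cs.IsReduced u := by
  simpa using h.take u.length

theorem IsReduced.of_append_right {u v : List B} (h : cs.IsReduced (u ++ v)) :
    cs.IsReduced v := by
  simpa using h.drop u.length

/-- The exchange condition. -/
theorem IsRightDescent.exists_deletion {ω : List B} {i : B}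
    (h : cs.IsRightDescent (cs.wordProd ω) i) :
    ∃ α x β, ω = α ++ x :: β ∧ cs.wordProd ω * cs.simple i = cs.wordProd (α ++ β) :=
  ((cs.isRightInversion_simple_iff_isRightDescent _ _).2 h).exists_deletion

theorem IsRightDescent.exists_deletion_append {γ δ : List B} {i : B}
    (h : cs.IsRightDescent (cs.wordProd (γ ++ δ)) i) :
    (∃ α x β, γ = α ++ x :: β ∧
      cs.wordProd (γ ++ δ) * cs.simple i = cs.wordProd (α ++ β ++ δ)) ∨
    (∃ α x β, δ = α ++ x :: β ∧ cs.wordProd δ * cs.simple i = cs.wordProd (α ++ β)) := by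
  obtain ⟨α, x, β, h1, h2⟩ := h.exists_deletion
  rcases append_eq_append_iff.1 h1 with ⟨as, rfl, h4⟩ | ⟨bs, h3, h4⟩
  · right
    refine ⟨as, x, β, h4, ?_⟩
    rw [append_assoc, wordProd_append, wordProd_append _ γ, mul_assoc] at h2
    exact mul_left_cancel h2
  · cases bs with
    | nil =>
      right
      refine ⟨[], x, β, by simpa using h4.symm, ?_⟩
      rw [append_nil] at h3
      subst h3
      rw [wordProd_append, wordProd_append, mul_assoc] at h2
      exact mul_left_cancel h2
    | cons y bs =>
      simp only [cons_append, cons.injEq] at h4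
      obtain ⟨rfl, rfl⟩ := h4
      left
      exact ⟨α, x, bs, h3, by rw [h2, append_assoc]⟩

variable (cs)

theorem exists_isReduced_sublist (q : List B) :
    ∃ u : List B, u.Sublist q ∧ cs.IsReduced u ∧ cs.wordProd u = cs.wordProd q := by
  induction q using List.reverseRecOn with
  | nil => exact ⟨[], Sublist.refl _, by simp [IsReduced], rfl⟩
  | append_singleton q z ih =>
    obtain ⟨u, huq, hu, h⟩ := ih
    have hprod : cs.wordProd (q ++ [z]) = cs.wordProd u * cs.simple z := by
      rw [wordProd_append, wordProd_singleton, h]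
    by_cases hr : cs.IsReduced (u ++ [z])
    · exact ⟨u ++ [z], huq.append (Sublist.refl _), hr,
        by rw [hprod, wordProd_append, wordProd_singleton]⟩
    · have hd := cs.isRightDescent_of_not_isReduced_concat hu hr
      obtain ⟨α, x, β, rfl, h'⟩ := hd.exists_deletion
      refine ⟨α ++ β, ?_, ?_, by rw [hprod, h']⟩
      · exact ((((Sublist.refl α).append (sublist_cons_self x β)).trans huq).trans
          (sublist_append_left q [z]))
      · have e1 := cs.isRightDescent_iff.1 hd
        rw [h', hu.eq] at e1
        simp only [length_append, length_cons] at e1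
        rw [IsReduced, length_append]
        omega

theorem eq_or_eq_of_simple_eq_wordProd {i j z : B} {q : List B} (hq : ∀ x ∈ q, x = i ∨ x = j)
    (h : cs.simple z = cs.wordProd q) : z = i ∨ z = j := by
  obtain ⟨u, huq, hu, h'⟩ := cs.exists_isReduced_sublist q
  have hl : u.length = 1 := by rw [← hu.eq, h', ← h, length_simple]
  obtain ⟨x, rfl⟩ := List.length_eq_one_iff.1 hl
  rw [wordProd_singleton, ← h] at h'
  rw [← cs.simple_injective h']
  exact hq x (huq.subset (by simp))

theorem mem_alternatingWord {i j x : B} {n : ℕ} (h : x ∈ alternatingWord i j n) :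
    x = i ∨ x = j := by
  induction n generalizing i j with
  | zero => simp [alternatingWord] at h
  | succ n ih =>
    rw [alternatingWord_succ, concat_eq_append, mem_append, mem_singleton] at h
    rcases h with h | h
    · exact (ih h).symm
    · exact Or.inr h

theorem alternatingWord_succ_eq_append (i j : B) (n : ℕ) :
    alternatingWord i j (n + 1) = alternatingWord j i n ++ [j] := by
  rw [alternatingWord_succ, concat_eq_append]

/-- The alternating suffix grows by exchange at alternate descents. The deleted letter lies in `γ`,
since a deletion in the suffix would make the longer alternating word non-reduced. -/
theorem exists_eq_wordProd_append_alternatingWord {w : W} {i j : B} (hij : i ≠ j)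
    (hi : cs.IsRightDescent w i) (hj : cs.IsRightDescent w j) {n : ℕ}
    (hn : M i j = 0 ∨ n ≤ M i j) :
    ∃ γ, w = cs.wordProd (γ ++ alternatingWord i j n) ∧ cs.length w = γ.length + n := by
  induction n generalizing i j with
  | zero =>
    obtain ⟨u, hu, rfl⟩ := cs.exists_isReduced w
    exact ⟨u, by simp [alternatingWord], by simpa using hu.eq⟩
  | succ n ih =>
    obtain ⟨γ, rfl, hl⟩ := ih hij.symm hj hi (by rw [M.symmetric j i]; omega)
    rcases hj.exists_deletion_append with ⟨α, x, β, rfl, h⟩ | ⟨α, x, β, h1, h2⟩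
    · refine ⟨α ++ β, ?_, ?_⟩
      · rw [alternatingWord_succ_eq_append, ← append_assoc, wordProd_append _ (α ++ β ++ _), ← h,
          wordProd_singleton, simple_mul_simple_cancel_right]
      · simp only [length_append, length_cons] at hl ⊢
        omega
    · have hred := (cs.isReduced_alternatingWord hij hn).eq
      rw [alternatingWord_succ_eq_append, wordProd_append, wordProd_singleton, h2] at hred
      have h3 := cs.length_wordProd_le (α ++ β)
      have h4 := congrArg List.length h1
      simp only [length_append, length_cons, length_alternatingWord, length_nil] at hred h3 h4
      omega

/-- Induction on `u` from its last letter `z`. If `z ≠ j`, exchange either shortens `γ` or deletes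
inside the suffix; the latter forces `z = i` and full length `M i j`, where the braid relation makes
the suffix end in `z`. -/
theorem alternatingWord_sublist {i j : B} (hij : i ≠ j) {n : ℕ} (hn : M i j = 0 ∨ n ≤ M i j)
    {u γ : List B} (hu : cs.IsReduced u)
    (h : cs.wordProd u = cs.wordProd (γ ++ alternatingWord i j n))
    (hl : u.length = γ.length + n) :
    (alternatingWord i j n).Sublist u ∨
      (M i j ≠ 0 ∧ n = M i j ∧ (alternatingWord j i n).Sublist u) := by
  induction u using List.reverseRecOn generalizing i j n γ with
  | nil =>
    simp only [length_nil] at hl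
    obtain rfl : n = 0 := by omega
    simp [alternatingWord]
  | append_singleton u z ih =>
    cases n with
    | zero => simp [alternatingWord]
    | succ n =>
    have hu' := hu.of_append_left
    have hlast : ∀ {a b : B}, a ≠ b → (M a b = 0 ∨ n + 1 ≤ M a b) → z = b →
        cs.wordProd (u ++ [z]) = cs.wordProd (γ ++ alternatingWord a b (n + 1)) →
        (alternatingWord a b (n + 1)).Sublist (u ++ [z]) := by
      rintro a b hab hn rfl h
      rw [alternatingWord_succ_eq_append, ← append_assoc, wordProd_append _ u,
        wordProd_append _ (γ ++ _)] at h
      simp only [length_append, length_singleton] at hl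
      rcases ih hab.symm (by rw [M.symmetric z a]; omega) hu' (mul_right_cancel h) (by omega)
        with h' | ⟨h0, h', -⟩
      · rw [alternatingWord_succ_eq_append]
        exact h'.append (Sublist.refl _)
      · rw [M.symmetric z a] at h0 h'
        omega
    by_cases hzj : z = j
    · exact Or.inl (hlast hij hn hzj h)
    have hd := cs.isRightDescent_wordProd_concat hu
    have hprod : cs.wordProd (u ++ [z]) * cs.simple z = cs.wordProd u := by
      rw [wordProd_append, wordProd_singleton, simple_mul_simple_cancel_right]
    rw [h] at hd
    rcases hd.exists_deletion_append with ⟨α, x, β, rfl, h'⟩ | ⟨α, x, β, h1, h2⟩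
    · rw [← h, hprod] at h'
      simp only [length_append, length_cons, length_nil] at hl
      rcases ih hij hn hu' h' (by simp only [length_append]; omega) with h'' | ⟨h0, hM, h''⟩
      · exact Or.inl (h''.trans (sublist_append_left _ _))
      · exact Or.inr ⟨h0, hM, h''.trans (sublist_append_left _ _)⟩
    · have hz : z = i ∨ z = j := by
        apply cs.eq_or_eq_of_simple_eq_wordProd
          (q := (alternatingWord i j (n + 1)).reverse ++ (α ++ β))
        · intro y hy
          rw [mem_append, mem_reverse] at hy
          rcases hy with hy | hy
          · exact mem_alternatingWord hy
          · apply mem_alternatingWord (n := n + 1)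
            rw [h1]
            simp only [mem_append, mem_cons] at hy ⊢
            tauto
        · rw [wordProd_append, wordProd_reverse, ← h2, inv_mul_cancel_left]
      obtain rfl := hz.resolve_right hzj
      have hnM : M z j ≠ 0 ∧ n + 1 = M z j := by
        by_contra hcon
        have hred := (cs.isReduced_alternatingWord hij.symm (n := n + 1 + 1)
          (by rw [M.symmetric j z]; omega)).eq
        rw [alternatingWord_succ_eq_append j z (n + 1), wordProd_append, wordProd_singleton, h2]
          at hred
        have h3 := cs.length_wordProd_le (α ++ β)
        have h4 := congrArg List.length h1
        simp only [length_append, length_cons, length_alternatingWord, length_nil] at hred h3 h4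
        omega
      refine Or.inr ⟨hnM.1, hnM.2, hlast hij.symm ?_ rfl ?_⟩
      · rw [M.symmetric j z]; exact hn
      · have := cs.wordProd_braidWord_eq z j
        rw [braidWord, braidWord, M.symmetric j z, ← hnM.2] at this
        rw [h, wordProd_append, wordProd_append, this]

/-- If a reduced word ends in `j` and the element that it represents has another right
descent `i`, then the word has the braid word of `i` and `j` as a subword. -/
theorem braidWord_sublist {u : List B} {i j : B} (hij : i ≠ j) (hu : cs.IsReduced (u ++ [j]))
    (hi : cs.IsRightDescent (cs.wordProd (u ++ [j])) i) :
    M i j ≠ 0 ∧ (braidWord M i j).Sublist (u ++ [j]) := by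
  have hj := cs.isRightDescent_wordProd_concat hu
  have h0 : M i j ≠ 0 := by
    intro h0
    -- With no bound on alternating suffixes, one can be chosen longer than the element itself.
    obtain ⟨γ, -, hl⟩ := cs.exists_eq_wordProd_append_alternatingWord hij hi hj
      (n := cs.length (cs.wordProd (u ++ [j])) + 1) (Or.inl h0)
    omega
  refine ⟨h0, ?_⟩
  obtain ⟨γ, h, hl⟩ := cs.exists_eq_wordProd_append_alternatingWord hij hi hj
    (n := M i j) (Or.inr le_rfl)
  rcases cs.alternatingWord_sublist hij (Or.inr le_rfl) hu h (by rw [← hl, hu.eq])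
    with h' | ⟨-, -, h'⟩
  · exact h'
  -- The other braid word ends in `i ≠ j`, so it lies in `u`; appending `j` gives an alternating
  -- word one letter too long, which contains the desired one.
  · obtain ⟨m, hm⟩ : ∃ m, M i j = m + 1 := ⟨M i j - 1, by omega⟩
    have h'' : (alternatingWord j i (M i j)).Sublist u := by
      rw [hm, alternatingWord_succ_eq_append] at h' ⊢
      have := h'.reverse
      simp only [reverse_append, reverse_singleton, singleton_append] at this
      rcases sublist_cons_iff.1 this with h3 | ⟨r, h3, -⟩
      · simpa using h3.reverse
      · exact absurd (cons.inj h3).1 hij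
    have h4 : (alternatingWord i j (M i j + 1)).Sublist (u ++ [j]) := by
      rw [alternatingWord_succ_eq_append]
      exact h''.append (Sublist.refl _)
    rw [alternatingWord_succ'] at h4
    exact (sublist_cons_self _ _).trans h4

end CoxeterSystem

/-! ### Comparison with the universal Coxeter group. -/

namespace CoxeterSystem

open List

variable {B : Type*} {W : Type*} [Group W] {M : CoxeterMatrix B} (cs : CoxeterSystem M W)

/-- The canonical homomorphism from the universal Coxeter group. -/
noncomputable def fromUniversal : (CoxeterMatrix.universal B).Group →* W :=
  (CoxeterMatrix.universal B).toCoxeterSystem.lift ⟨cs.simple, fun i j => by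
    by_cases h : i = j
    · simp [h]
    · simp [CoxeterMatrix.universal, h]⟩

theorem fromUniversal_simple (i : B) :
    cs.fromUniversal ((CoxeterMatrix.universal B).toCoxeterSystem.simple i) = cs.simple i :=
  lift_apply_simple _ _ i

theorem fromUniversal_wordProd (s : List B) :
    cs.fromUniversal ((CoxeterMatrix.universal B).toCoxeterSystem.wordProd s) =
      cs.wordProd s := by
  rw [wordProd, map_list_prod, map_map, wordProd]
  congr 1
  exact map_congr_left fun i _ => cs.fromUniversal_simple i

variable {cs}

theorem IsReduced.universal {s : List B} (h : cs.IsReduced s) :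
    (CoxeterMatrix.universal B).toCoxeterSystem.IsReduced s := by
  obtain ⟨u, hu, hsu⟩ := (CoxeterMatrix.universal B).toCoxeterSystem.exists_isReduced
    ((CoxeterMatrix.universal B).toCoxeterSystem.wordProd s)
  have h' := congrArg cs.fromUniversal hsu
  rw [fromUniversal_wordProd, fromUniversal_wordProd] at h'
  apply le_antisymm (length_wordProd_le _ s)
  rw [hsu, hu.eq, ← h.eq, h']
  exact cs.length_wordProd_le u

/-- Different last letters would be two right descents, which requires a finite off-diagonal entry.
-/
theorem IsReduced.eq_of_wordProd_eq_universal {u u' : List B}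
    (hu : (CoxeterMatrix.universal B).toCoxeterSystem.IsReduced u)
    (hu' : (CoxeterMatrix.universal B).toCoxeterSystem.IsReduced u')
    (h : (CoxeterMatrix.universal B).toCoxeterSystem.wordProd u =
      (CoxeterMatrix.universal B).toCoxeterSystem.wordProd u') : u = u' := by
  have hl : u.length = u'.length := by rw [← hu.eq, ← hu'.eq, h]
  induction u using List.reverseRecOn generalizing u' with
  | nil => exact (List.length_eq_zero_iff.1 hl.symm).symm
  | append_singleton u y ih =>
    rcases eq_nil_or_concat' u' with rfl | ⟨u', y', rfl⟩
    · simp at hl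
    by_cases hy : y' = y
    · subst hy
      rw [wordProd_append, wordProd_append] at h
      rw [ih hu.of_append_left hu'.of_append_left (mul_right_cancel h) (by simpa using hl)]
    · have hd := isRightDescent_wordProd_concat _ hu'
      rw [← h] at hd
      exact absurd (by simp [CoxeterMatrix.universal, hy]) (braidWord_sublist _ hy hu hd).1

theorem IsReduced.sublist_of_wordProd_eq_universal {u q : List B}
    (hu : (CoxeterMatrix.universal B).toCoxeterSystem.IsReduced u)
    (h : (CoxeterMatrix.universal B).toCoxeterSystem.wordProd u =
      (CoxeterMatrix.universal B).toCoxeterSystem.wordProd q) : u.Sublist q := by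
  obtain ⟨u', hq, hu', h'⟩ :=
    (CoxeterMatrix.universal B).toCoxeterSystem.exists_isReduced_sublist q
  rwa [hu.eq_of_wordProd_eq_universal hu' (h.trans h'.symm)]

variable (cs)

theorem exists_prefix_of_not_isReduced {t : List B} (ht : ¬ cs.IsReduced t) :
    ∃ p i β, t = p ++ i :: β ∧ cs.IsReduced p ∧ ¬ cs.IsReduced (p ++ [i]) := by
  induction t using List.reverseRecOn with
  | nil => simp [IsReduced] at ht
  | append_singleton t z ih =>
    by_cases h : cs.IsReduced t
    · exact ⟨t, z, [], rfl, h, ht⟩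
    · obtain ⟨p, i, β, rfl, h1, h2⟩ := ih h
      exact ⟨p, i, β ++ [z], by simp, h1, h2⟩

/-- Exchange at the first letter `i` that destroys reducedness deletes an earlier letter `x`. -/
theorem exists_factor_of_not_isReduced {t : List B} (ht : ¬ cs.IsReduced t) :
    ∃ α x b i β, t = α ++ (x :: b ++ i :: β) ∧ cs.IsReduced (x :: b) ∧ cs.IsReduced (b ++ [i]) ∧
      cs.wordProd (x :: b) = cs.wordProd (b ++ [i]) := by
  obtain ⟨p, i, β, rfl, hp, hpi⟩ := cs.exists_prefix_of_not_isReduced ht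
  obtain ⟨α, x, b, rfl, h⟩ := (cs.isRightDescent_of_not_isReduced_concat hp hpi).exists_deletion
  have hxb := hp.of_append_right
  rw [wordProd_append, wordProd_append, mul_assoc] at h
  have h' : cs.wordProd (x :: b) = cs.wordProd (b ++ [i]) := by
    rw [wordProd_append _ b, ← mul_left_cancel h, wordProd_singleton,
      simple_mul_simple_cancel_right]
  refine ⟨α, x, b, i, β, by simp, hxb, ?_, h'⟩
  rw [IsReduced, ← h', hxb.eq]
  simp

/-- Alternation continues across the middle `i`, as both sides meet it with `j`. The last letter
depends on the parity of `k`, so only the pair is recorded. -/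
theorem alternatingWord_append_cons_reverse (i j : B) (m k : ℕ) :
    ∃ p q, ((p = i ∧ q = j) ∨ (p = j ∧ q = i)) ∧
      alternatingWord i j m ++ i :: (alternatingWord i j k).reverse =
        alternatingWord p q (m + k + 1) := by
  induction k generalizing i j m with
  | zero =>
    exact ⟨j, i, Or.inr ⟨rfl, rfl⟩, by rw [add_zero, alternatingWord_succ_eq_append]; rfl⟩
  | succ k ih =>
    obtain ⟨p, q, hpq, h⟩ := ih j i (m + 1)
    refine ⟨p, q, hpq.symm, ?_⟩
    rw [show m + (k + 1) + 1 = m + 1 + k + 1 by ring, ← h, alternatingWord_succ_eq_append j i m,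
      alternatingWord_succ_eq_append i j k]
    simp

theorem alternatingWord_two_mul (i j : B) (m : ℕ) :
    alternatingWord i j (2 * m) = pairPowerWord i j m := by
  induction m with
  | zero => rfl
  | succ m ih =>
    rw [show 2 * (m + 1) = 2 * m + 1 + 1 by ring, alternatingWord_succ', alternatingWord_succ', ih]
    simp [pairPowerWord, replicate_succ]

theorem _root_.pairPowerWord_swap (i j : B) (m : ℕ) :
    j :: pairPowerWord i j m ++ [i] = pairPowerWord j i (m + 1) := by
  induction m with
  | zero => rfl
  | succ m ih =>
    have h : ∀ a b : B, ∀ n, pairPowerWord a b (n + 1) = a :: b :: pairPowerWord a b n := by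
      intro a b n; simp [pairPowerWord, replicate_succ]
    rw [h j i (m + 1), ← ih, h i j m]
    rfl

theorem _root_.pairPowerWord_rotate (i j : B) (m n : ℕ) :
    (pairPowerWord i j m).rotate n = pairPowerWord i j m ∨
      (pairPowerWord i j m).rotate n = pairPowerWord j i m := by
  induction n generalizing i j with
  | zero => simp
  | succ n ih =>
    have h : (pairPowerWord i j m).rotate 1 = pairPowerWord j i m := by
      cases m with
      | zero => rfl
      | succ m =>
        rw [← pairPowerWord_swap i j m]
        simp [pairPowerWord, replicate_succ]
    rw [add_comm, ← rotate_rotate, h]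
    exact (ih j i).symm

theorem _root_.CoxeterMatrix.hasBraidRelationSubword_of_append {i j : B} (hij : i ≠ j)
    (h0 : M i j ≠ 0) {u v : List B} (h : (pairPowerWord i j (M i j)).Sublist (u ++ v)) :
    M.HasBraidRelationSubword (v ++ u) := by
  obtain ⟨l₁, l₂, hl, h₁, h₂⟩ := sublist_append_iff.1 h
  have hr := pairPowerWord_rotate i j (M i j) l₁.length
  have h' : ((pairPowerWord i j (M i j)).rotate l₁.length).Sublist (v ++ u) := by
    rw [hl, rotate_append_length_eq]
    exact h₂.append h₁
  rcases hr with hr | hr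
  · exact ⟨i, j, hij, h0, by rwa [← hr]⟩
  · refine ⟨j, i, hij.symm, by rwa [M.symmetric j i], ?_⟩
    rwa [M.symmetric j i, ← hr]

theorem _root_.CoxeterMatrix.HasBraidRelationSubword.mono {u v : List B}
    (h : M.HasBraidRelationSubword u) (huv : u.Sublist v) : M.HasBraidRelationSubword v := by
  obtain ⟨i, j, hij, h0, h⟩ := h
  exact ⟨i, j, hij, h0, h.trans huv⟩

/-- A word without braid relation subwords that represents the identity of a Coxeter group
already represents the identity of the universal Coxeter group. -/
theorem universal_wordProd_eq_one {t : List B} (ht : cs.wordProd t = 1)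
    (hbraid : ¬ M.HasBraidRelationSubword t) :
    (CoxeterMatrix.universal B).toCoxeterSystem.wordProd t = 1 := by
  induction hn : t.length using Nat.strong_induction_on generalizing t with
  | _ n ih =>
    by_cases hnil : t = []
    · rw [hnil, wordProd_nil]
    have hred : ¬ cs.IsReduced t := by
      rw [IsReduced, ht, length_one]
      exact fun h => hnil (List.length_eq_zero_iff.1 h.symm)
    obtain ⟨α, x, b, i, β, rfl, hxb, hbi, hprod⟩ := cs.exists_factor_of_not_isReduced hred
    have hsub : (α ++ (b ++ β)).Sublist (α ++ (x :: b ++ i :: β)) :=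
      (Sublist.refl α).append ((sublist_cons_self x b).append (sublist_cons_self i β))
    have ht' : cs.wordProd (α ++ (b ++ β)) = 1 := by
      rw [← ht, wordProd_append, wordProd_append, wordProd_append, wordProd_append, hprod,
        wordProd_append, wordProd_singleton, wordProd_cons]
      simp [mul_assoc]
    have hU := ih (α ++ (b ++ β)).length
      (by rw [← hn]; simp only [length_append, length_cons]; omega) ht'
      (fun h => hbraid (h.mono hsub)) rfl
    rcases eq_nil_or_concat' b with rfl | ⟨b, y, rfl⟩
    · have hxi : x = i := by
        apply cs.simple_injective
        simpa using hprod
      subst hxi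
      rw [← hU]
      simp only [wordProd_append, wordProd_cons, wordProd_nil, mul_one, one_mul,
        simple_mul_simple_cancel_left]
    exfalso
    apply hbraid
    have hiy : i ≠ y := by
      rintro rfl
      have := hbi.eq
      rw [append_assoc, wordProd_append, singleton_append, wordProd_cons, wordProd_singleton,
        simple_mul_simple_self, mul_one] at this
      have h' := cs.length_wordProd_le b
      simp only [length_append, length_cons, length_nil] at this
      omega
    have hdesc : cs.IsRightDescent (cs.wordProd (x :: b ++ [y])) i := by
      rw [cons_append, hprod]
      exact cs.isRightDescent_wordProd_concat hbi
    obtain ⟨h0, hbw⟩ := cs.braidWord_sublist hiy hxb hdesc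
    obtain ⟨m, hm⟩ : ∃ m, M i y = m + 1 := ⟨M i y - 1, by omega⟩
    have htail : (alternatingWord i y m).Sublist (b ++ [y]) := by
      rw [braidWord, hm, alternatingWord_succ'] at hbw
      exact hbw.tail
    -- Conjugating the universally trivial word shows that `β α` represents the inverse of `b y`,
    -- whose reduced word is a subword of every word for it.
    have hrev : (b ++ [y]).reverse.Sublist (β ++ α) := by
      apply IsReduced.sublist_of_wordProd_eq_universal
      · exact (hxb.of_append_right (u := [x])).reverse.universal
      · rw [wordProd_append, wordProd_append _ (b ++ [y]), mul_eq_one_iff_inv_eq] at hU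
        rw [wordProd_reverse, wordProd_append _ β, inv_eq_iff_mul_eq_one, ← mul_assoc, ← hU,
          inv_mul_cancel]
    -- The lengths add up to `M i y + 1 + (M i y - 1) = 2 * M i y`.
    obtain ⟨p, q, hpq, h⟩ := alternatingWord_append_cons_reverse i y (M i y) m
    rw [show M i y + m + 1 = 2 * M i y by omega, alternatingWord_two_mul] at h
    have hpp : (pairPowerWord p q (M i y)).Sublist
        ((x :: (b ++ [y]) ++ i :: β) ++ α) := by
      rw [← h, append_assoc, cons_append (a := i)]
      exact hbw.append ((htail.reverse.trans hrev).cons_cons i)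
    have hM : M p q = M i y ∧ p ≠ q := by
      rcases hpq with ⟨rfl, rfl⟩ | ⟨rfl, rfl⟩
      · exact ⟨rfl, hiy⟩
      · exact ⟨M.symmetric _ _, hiy.symm⟩
    rw [← hM.1] at hpp
    exact CoxeterMatrix.hasBraidRelationSubword_of_append hM.2 (by rwa [hM.1]) hpp

/-- Converse of Dyer's theorem: each deleted letter, moved to the left past the kept letters before
it, becomes a reflection. -/
theorem exists_prod_eq_wordProd_of_sublist {t s : List B} (h : t.Sublist s)
    (ht : cs.wordProd t = 1) :
    ∃ l : List W, l.length + t.length = s.length ∧ (∀ r ∈ l, cs.IsReflection r) ∧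
      l.prod = cs.wordProd s := by
  suffices h' : ∃ l : List W, l.length + t.length = s.length ∧ (∀ r ∈ l, cs.IsReflection r) ∧
      l.prod * cs.wordProd t = cs.wordProd s by simpa [ht] using h'
  clear ht
  induction h with
  | slnil => exact ⟨[], by simp⟩
  | @cons t s x _ ih =>
    obtain ⟨l, hl, hr, hp⟩ := ih
    refine ⟨cs.simple x :: l, by simp only [length_cons]; omega, ?_, ?_⟩
    · simp only [mem_cons, forall_eq_or_imp]
      exact ⟨cs.isReflection_simple x, hr⟩
    · rw [prod_cons, mul_assoc, hp, wordProd_cons]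
  | @cons_cons t s x _ ih =>
    obtain ⟨l, hl, hr, hp⟩ := ih
    refine ⟨l.map (MulAut.conj (cs.simple x)), by simp only [length_cons, length_map]; omega,
      ?_, ?_⟩
    · intro r hr'
      obtain ⟨r', h', rfl⟩ := mem_map.1 hr'
      exact (hr r' h').conj _
    · rw [← map_list_prod, wordProd_cons, wordProd_cons, ← hp]
      simp [mul_assoc]

theorem reflectionLength_le {l : List W} (hl : ∀ r ∈ l, cs.IsReflection r) :
    cs.reflectionLength l.prod ≤ l.length :=
  Nat.sInf_le ⟨l, rfl, fun r hr => Or.inl (hl r hr), rfl⟩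

theorem exists_prod_eq_length_eq_reflectionLength (w : W) :
    ∃ l : List W, l.length = cs.reflectionLength w ∧ (∀ r ∈ l, cs.IsReflection r) ∧
      l.prod = w := by
  obtain ⟨l, hl, hr, hp⟩ := Nat.sInf_mem (cs.reflectionLength_set_nonempty w)
  refine ⟨l, hl, fun r h => ?_, hp⟩
  rcases hr r h with h' | h'
  · exact h'
  · have := IsReflection.isReflection_inv h'
    rwa [inv_inv] at this

theorem IsReflection.fromUniversal {r : (CoxeterMatrix.universal B).Group}
    (h : (CoxeterMatrix.universal B).toCoxeterSystem.IsReflection r) :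
    cs.IsReflection (cs.fromUniversal r) := by
  obtain ⟨w, i, rfl⟩ := h
  exact ⟨cs.fromUniversal w, i, by
    rw [map_mul, map_mul, map_inv, fromUniversal_simple]⟩

end CoxeterSystem

theorem mainTheorem5 {B : Type*} [Finite B] {W : Type*} [Group W] {M : CoxeterMatrix B}
    (cs : CoxeterSystem M W) (v : W) (s : List B)
    (hs : cs.IsReduced s) (hsv : cs.wordProd s = v)
    (hv : ∀ u : List B, cs.IsReduced u → cs.wordProd u = v → ¬ M.HasBraidRelationSubword u) :
    cs.reflectionLength v =
      (CoxeterMatrix.universal B).toCoxeterSystem.reflectionLength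
        ((CoxeterMatrix.universal B).toCoxeterSystem.wordProd s) := by
  apply le_antisymm
  · obtain ⟨l, hl, hr, hp⟩ :=
      (CoxeterMatrix.universal B).toCoxeterSystem.exists_prod_eq_length_eq_reflectionLength
        ((CoxeterMatrix.universal B).toCoxeterSystem.wordProd s)
    have h := cs.reflectionLength_le (l := l.map cs.fromUniversal) (by
      intro r h
      obtain ⟨r', h', rfl⟩ := List.mem_map.1 h
      exact CoxeterSystem.IsReflection.fromUniversal cs (hr r' h'))
    rwa [← map_list_prod, hp, cs.fromUniversal_wordProd, hsv, List.length_map, hl] at h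
  · obtain ⟨l, hl, hr, hp⟩ := cs.exists_prod_eq_length_eq_reflectionLength v
    obtain ⟨t, hts, ht, hle⟩ :=
      CoxeterSystem.canDelete_of_wordProd_eq_prod hr (hsv.trans hp.symm)
    have hU := cs.universal_wordProd_eq_one ht fun h => hv s hs hsv (h.mono hts)
    obtain ⟨l', hl', hr', hp'⟩ :=
      (CoxeterMatrix.universal B).toCoxeterSystem.exists_prod_eq_wordProd_of_sublist hts hU
    rw [← hp', ← hl]
    exact (CoxeterSystem.reflectionLength_le _ hr').trans (by omega)
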